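/- Let $n\ge 2$, let $(M,g)$ be a smooth $n$-dimensional Riemannian manifold with Levi-Civita connection $\nabla$, let $p\in M$, and let $e_1,\dots,e_n$ be an orthonormal basis of $T_pM$. All components below are taken at $p$ with respect to this basis, and indices after a comma denote covariant derivatives. Let $R_{ijkl}=g(R(e_k,e_l)e_j,e_i)$ with $R(X,Y)Z=\nabla_X\nabla_YZ-\nabla_Y\nabla_XZ-\nabla_{[X,Y]}Z$ be the Riemann curvature tensor, $R_{ij}=\sum_k R_{kikj}$ the Ricci tensor and $R=\sum_i R_{ii}$ the scalar curvature. Put $$T_{ijk}=\sum_{l=1}^n R_{lijk,l},\qquad T^1_i=\sum_{l} T_{ill},\quad T^2_i=\sum_{l} T_{lil},\quad T^3_i=\sum_{l} T_{lli},$$ and for $x,y,z\in\mathbb R^3$ let $$F_{ijk}(x,y,z)=T_{ijk}+x_1T^1_i\delta_{jk}+x_2T^1_j\delta_{ik}+x_3T^1_k\delta_{ij}+y_1T^2_i\delta_{jk}+y_2T^2_j\delta_{ik}+y_3T^2_k\delta_{ij}+z_1T^3_i\delta_{jk}+z_2T^3_j\delta_{ik}+z_3T^3_k\delta_{ij}.$$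 Then among the tensors $F(x,y,z)$, $x,y,z\in\mathbb R^3$, there is exactly one that minimizes $\|F\|^2=\sum_{i,j,k}F_{ijk}^2$, and it is the Cotton tensor $$C_{ijk}=R_{ik,j}-R_{ij,k}-\frac{1}{2(n-1)}\left(R_{,j}\delta_{ik}-R_{,k}\delta_{ij}\right).$$ -/

import Mathlib

open scoped Manifold ContDiff

noncomputable section

namespace CottonMinimal

/-! ### The third-order minimal norm problem

A third-order covariant tensor on an `n`-dimensional inner product space is given by its
components in an orthonormal basis. -/

section MinimalNorm

variable {n : ℕ}

/-- The Kronecker symbol `δ_{ij}`. -/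
def kron (i j : Fin n) : ℝ := if i = j then 1 else 0

/-- The trace `T¹_i = ∑ l, T_{ill}`. -/
def trace₁ (T : Fin n → Fin n → Fin n → ℝ) (i : Fin n) : ℝ := ∑ l, T i l l

/-- The trace `T²_i = ∑ l, T_{lil}`. -/
def trace₂ (T : Fin n → Fin n → Fin n → ℝ) (i : Fin n) : ℝ := ∑ l, T l i l

/-- The trace `T³_i = ∑ l, T_{lli}`. -/
def trace₃ (T : Fin n → Fin n → Fin n → ℝ) (i : Fin n) : ℝ := ∑ l, T l l i

/-- The squared norm `∑ F_{ijk}²` of a tensor given in an orthonormal basis. -/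
def normSq (F : Fin n → Fin n → Fin n → ℝ) : ℝ := ∑ i, ∑ j, ∑ k, F i j k ^ 2

/-- The nine-parameter family of competitors `F_{ijk}(x, y, z)`; the parameters
`x₁, x₂, x₃` are `x 0, x 1, x 2`, and likewise for `y` and `z`. -/
def competitor (T : Fin n → Fin n → Fin n → ℝ) (x y z : Fin 3 → ℝ) (i j k : Fin n) : ℝ :=
  T i j k
    + x 0 * trace₁ T i * kron j k + x 1 * trace₁ T j * kron i k + x 2 * trace₁ T k * kron i j
    + y 0 * trace₂ T i * kron j k + y 1 * trace₂ T j * kron i k + y 2 * trace₂ T k * kron i j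
    + z 0 * trace₃ T i * kron j k + z 1 * trace₃ T j * kron i k + z 2 * trace₃ T k * kron i j

/-- `F` is a minimal norm tensor of `T`: it belongs to the nine-parameter family of `T`, and no
member of the family has a smaller norm. -/
def IsMinimalNormTensor (T F : Fin n → Fin n → Fin n → ℝ) : Prop :=
  (∃ x y z : Fin 3 → ℝ, F = competitor T x y z) ∧
    ∀ x y z : Fin 3 → ℝ, normSq F ≤ normSq (competitor T x y z)

end MinimalNorm

/-! ### Levi-Civita connection and curvature in coordinates

`G` is the matrix of metric coefficients `g_{ab}` as a function of the coordinates. A covariant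
tensor field of order `k` is given by its coefficients `S y β` at the point with coordinates `y`,
with `β : Fin k → Fin n` the multi-index. -/

section Coordinates

variable {n : ℕ}

/-- The partial derivative `∂_a f` at `y`. -/
def pderiv (a : Fin n) (f : EuclideanSpace ℝ (Fin n) → ℝ) (y : EuclideanSpace ℝ (Fin n)) : ℝ :=
  fderiv ℝ f y (EuclideanSpace.single a 1)

variable (G : EuclideanSpace ℝ (Fin n) → Matrix (Fin n) (Fin n) ℝ)

/-- The Christoffel symbols of the Levi-Civita connection, `∇_{∂_a} ∂_b = ∑ c, Γ^c_{ab} ∂_c`: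
`Γ^c_{ab} = ½ ∑ d, g^{cd} (∂_a g_{bd} + ∂_b g_{ad} - ∂_d g_{ab})`. -/
def christoffel (c a b : Fin n) (y : EuclideanSpace ℝ (Fin n)) : ℝ :=
  (1 / 2) * ∑ d, (G y)⁻¹ c d *
    (pderiv a (fun u => G u b d) y + pderiv b (fun u => G u a d) y
      - pderiv d (fun u => G u a b) y)

/-- The coefficient of `∂_d` in
`R(∂_a, ∂_b) ∂_c = ∇_{∂_a} ∇_{∂_b} ∂_c - ∇_{∂_b} ∇_{∂_a} ∂_c`. -/
def curvature (d c a b : Fin n) (y : EuclideanSpace ℝ (Fin n)) : ℝ :=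
  pderiv a (christoffel G d b c) y - pderiv b (christoffel G d a c) y
    + ∑ e, (christoffel G d a e y * christoffel G e b c y
        - christoffel G d b e y * christoffel G e a c y)

/-- The Riemann curvature tensor `R_{abcd} = ⟨R(∂_c, ∂_d) ∂_b, ∂_a⟩`. With this convention the
round sphere has `R_{abab} > 0` for `a ≠ b`. -/
def riemann (y : EuclideanSpace ℝ (Fin n)) (β : Fin 4 → Fin n) : ℝ :=
  ∑ e, G y (β 0) e * curvature G e (β 1) (β 2) (β 3) y

/-- The Ricci tensor `R_{ab} = ∑ g^{cd} R_{cadb}`. -/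
def ricci (y : EuclideanSpace ℝ (Fin n)) (β : Fin 2 → Fin n) : ℝ :=
  ∑ c, ∑ d, (G y)⁻¹ c d * riemann G y ![c, β 0, d, β 1]

/-- The scalar curvature `R = ∑ g^{ab} R_{ab}`, a tensor field of order `0`. -/
def scalarCurvature (y : EuclideanSpace ℝ (Fin n)) (_ : Fin 0 → Fin n) : ℝ :=
  ∑ a, ∑ b, (G y)⁻¹ a b * ricci G y ![a, b]

/-- The covariant derivative of a covariant tensor field of order `k` in the direction `∂_m`,
`(∇_m S)_β = ∂_m S_β - ∑ s, ∑ e, Γ^e_{m β_s} S_{β_1 … e … β_k}` (with `e` in the place `s`). -/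
def covDeriv {k : ℕ} (S : EuclideanSpace ℝ (Fin n) → (Fin k → Fin n) → ℝ) (m : Fin n)
    (y : EuclideanSpace ℝ (Fin n)) (β : Fin k → Fin n) : ℝ :=
  pderiv m (fun u => S u β) y
    - ∑ s, ∑ e, christoffel G e m (β s) y * S y (Function.update β s e)

/-- The components `S_{α_1 … α_k, m}` of the covariant derivative of `S` at the point `y`, with
respect to the vectors `e 0, e 1, …`, where `e i a` is the coefficient of `∂_a` in the `i`-th
vector; the index after the comma is the direction of differentiation. -/
def frameCovDeriv {k : ℕ} (S : EuclideanSpace ℝ (Fin n) → (Fin k → Fin n) → ℝ)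
    (y : EuclideanSpace ℝ (Fin n)) (e : Fin n → EuclideanSpace ℝ (Fin n))
    (α : Fin k → Fin n) (m : Fin n) : ℝ :=
  ∑ β : Fin k → Fin n, ∑ c : Fin n,
    (∏ s, e (α s) (β s)) * e m c * covDeriv G S c y β

/-- The divergence of the Riemann tensor, `T_{ijk} = ∑ l, R_{lijk,l}`, in the orthonormal
frame `e` at `y`. -/
def divRiemann (y : EuclideanSpace ℝ (Fin n)) (e : Fin n → EuclideanSpace ℝ (Fin n))
    (i j k : Fin n) : ℝ :=
  ∑ l, frameCovDeriv G (riemann G) y e ![l, i, j, k] l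

/-- The Cotton tensor
`C_{ijk} = R_{ik,j} - R_{ij,k} - (R_{,j} δ_{ik} - R_{,k} δ_{ij}) / (2 (n - 1))` in the
orthonormal frame `e` at `y`. -/
def cotton (y : EuclideanSpace ℝ (Fin n)) (e : Fin n → EuclideanSpace ℝ (Fin n))
    (i j k : Fin n) : ℝ :=
  frameCovDeriv G (ricci G) y e ![i, k] j - frameCovDeriv G (ricci G) y e ![i, j] k
    - 1 / (2 * ((n : ℝ) - 1)) *
      (frameCovDeriv G (scalarCurvature G) y e ![] j * kron i k
        - frameCovDeriv G (scalarCurvature G) y e ![] k * kron i j)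

end Coordinates

/-! ### Passing from the manifold to a chart -/

section Manifold

variable {n : ℕ} {M : Type*} [TopologicalSpace M] [ChartedSpace (EuclideanSpace ℝ (Fin n)) M]
  [IsManifold (𝓡 n) ∞ M]

/-- The coefficients `g_{ab} = g(∂_a, ∂_b)` of a Riemannian metric in the chart `φ`, where the
coordinate vector `∂_a` at `φ⁻¹ y` is the image of the `a`-th standard vector under the
differential of `φ⁻¹` at `y`. -/
def chartMetric
    (g : Bundle.ContMDiffRiemannianMetric (𝓡 n) ∞ (EuclideanSpace ℝ (Fin n))
      (TangentSpace (𝓡 n) : M → Type _))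
    (φ : OpenPartialHomeomorph M (EuclideanSpace ℝ (Fin n)))
    (y : EuclideanSpace ℝ (Fin n)) : Matrix (Fin n) (Fin n) ℝ :=
  Matrix.of fun a b =>
    g.inner (φ.symm y)
      (mfderiv (𝓡 n) (𝓡 n) φ.symm y (EuclideanSpace.single a (1 : ℝ) : EuclideanSpace ℝ (Fin n)))
      (mfderiv (𝓡 n) (𝓡 n) φ.symm y (EuclideanSpace.single b (1 : ℝ) : EuclideanSpace ℝ (Fin n)))

/-- The coordinates of tangent vectors `e 0, e 1, …` at `p` in the chart `φ`. -/
def chartFrame (φ : OpenPartialHomeomorph M (EuclideanSpace ℝ (Fin n))) (p : M)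
    (e : Fin n → TangentSpace (𝓡 n) p) (i : Fin n) : EuclideanSpace ℝ (Fin n) :=
  mfderiv (𝓡 n) (𝓡 n) φ p (e i)

end Manifold

end CottonMinimal

end

/-! Any two members of the family differ by a tensor $a_i\delta_{jk}+b_j\delta_{ik}+c_k\delta_{ij}$.
Pairing a tensor $C$ with such a pure trace gives $\langle a,T^1(C)\rangle+\langle
b,T^2(C)\rangle+\langle c,T^3(C)\rangle$, so totally trace-free tensors are orthogonal to pure
traces. Hence if some member $C$ is totally trace-free, Pythagoras gives $\|F\|^2=\|C\|^2+\|F-C\|^2$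
on the whole family, and $C$ is the only minimizer. Uniqueness concerns the tensor, not its
parameters: here $T^1=0$ and $T^3=-T^2$, so many parameters give the same tensor.

It remains to see that the Cotton tensor is in the family and trace-free. The second Bianchi
identity, contracted once, gives $T_{ijk}=R_{ik,j}-R_{ij,k}$ (`divRiemann_eq`); contracted twice,
$2\sum_l R_{il,l}=R_{,i}$ (`contracted_bianchi`). So $T^2_i=-T^3_i=\frac12R_{,i}$, and the
correction in the Cotton tensor is the multiple of these traces that removes all three traces.

The curvature identities are proved in a chart by matrix calculus: with connection matrices
$A_m=(\Gamma^c_{mb})$ the curvature is $\partial_aA_b-\partial_bA_a+[A_a,A_b]$. They pass to the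
orthonormal frame through $g^{ab}=\sum_l e_l^a e_l^b$ (`IsOrthonormalFrame.inv_apply`). -/

noncomputable section

namespace CottonMinimal

/-! ### Linear algebra: orthogonality of trace-free and pure-trace tensors. -/

section MinimalNorm

variable {n : ℕ}

/-- The tensor `a_i δ_{jk} + b_j δ_{ik} + c_k δ_{ij}`. -/
def pureTrace (a b c : Fin n → ℝ) (i j k : Fin n) : ℝ :=
  a i * kron j k + b j * kron i k + c k * kron i j

lemma sum_mul_pureTrace (C : Fin n → Fin n → Fin n → ℝ) (a b c : Fin n → ℝ) :
    ∑ i, ∑ j, ∑ k, C i j k * pureTrace a b c i j k =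
      ∑ i, a i * trace₁ C i + ∑ i, b i * trace₂ C i + ∑ i, c i * trace₃ C i := by
  have h1 : ∑ i, ∑ j, ∑ k, C i j k * (a i * kron j k) = ∑ i, a i * trace₁ C i := by
    simp [kron, trace₁, Finset.mul_sum, mul_comm]
  have h2 : ∑ i, ∑ j, ∑ k, C i j k * (b j * kron i k) = ∑ i, b i * trace₂ C i := by
    rw [Finset.sum_comm]
    simp [kron, trace₂, Finset.mul_sum, mul_comm]
  have h3 : ∑ i, ∑ j, ∑ k, C i j k * (c k * kron i j) = ∑ i, c i * trace₃ C i := by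
    have : ∀ i, ∑ j, ∑ k, C i j k * (c k * kron i j) = ∑ k, C i i k * c k := fun i => by
      rw [Finset.sum_comm]
      simp [kron]
    rw [Finset.sum_congr rfl fun i _ => this i, Finset.sum_comm]
    simp [trace₃, Finset.mul_sum, mul_comm]
  simp only [pureTrace, mul_add, Finset.sum_add_distrib, h1, h2, h3]

/-- Pythagoras: by `sum_mul_pureTrace` the cross term only involves the three traces of `C`. -/
lemma normSq_add_pureTrace (C : Fin n → Fin n → Fin n → ℝ) (h1 : trace₁ C = 0)
    (h2 : trace₂ C = 0) (h3 : trace₃ C = 0) (a b c : Fin n → ℝ) :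
    normSq (fun i j k => C i j k + pureTrace a b c i j k) =
      normSq C + normSq (pureTrace a b c) := by
  have h := sum_mul_pureTrace C a b c
  simp only [h1, h2, h3, Pi.zero_apply, mul_zero, Finset.sum_const_zero, add_zero] at h
  have : ∀ i j k, (C i j k + pureTrace a b c i j k) ^ 2 =
      C i j k ^ 2 + pureTrace a b c i j k ^ 2 + 2 * (C i j k * pureTrace a b c i j k) :=
    fun i j k => by ring
  simp only [normSq, this, Finset.sum_add_distrib, ← Finset.mul_sum, h, mul_zero, add_zero]

lemma normSq_nonneg (F : Fin n → Fin n → Fin n → ℝ) : 0 ≤ normSq F :=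
  Finset.sum_nonneg fun _ _ => Finset.sum_nonneg fun _ _ => Finset.sum_nonneg fun _ _ =>
    sq_nonneg _

lemma eq_zero_of_normSq_eq_zero {F : Fin n → Fin n → Fin n → ℝ} (h : normSq F = 0) (i j k : Fin n) :
    F i j k = 0 := by
  have h1 := (Finset.sum_eq_zero_iff_of_nonneg fun _ _ => Finset.sum_nonneg fun _ _ =>
    Finset.sum_nonneg fun _ _ => sq_nonneg _).1 h i (Finset.mem_univ i)
  have h2 := (Finset.sum_eq_zero_iff_of_nonneg fun _ _ =>
    Finset.sum_nonneg fun _ _ => sq_nonneg _).1 h1 j (Finset.mem_univ j)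
  have h3 := (Finset.sum_eq_zero_iff_of_nonneg fun _ _ => sq_nonneg _).1 h2 k (Finset.mem_univ k)
  exact pow_eq_zero_iff two_ne_zero |>.1 h3

/-- A totally trace-free competitor is the unique minimal norm tensor. -/
theorem isMinimalNormTensor_iff_of_trace_eq_zero {T C F : Fin n → Fin n → Fin n → ℝ}
    {x₀ y₀ z₀ : Fin 3 → ℝ} (hC : C = competitor T x₀ y₀ z₀) (h1 : trace₁ C = 0)
    (h2 : trace₂ C = 0) (h3 : trace₃ C = 0) :
    IsMinimalNormTensor T F ↔ F = C := by
  -- Each competitor is affine in its parameters, so its difference from `C` collects the parameter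
  -- differences into one coefficient vector per Kronecker pattern.
  have key : ∀ x y z, ∃ a b c, competitor T x y z =
      fun i j k => C i j k + pureTrace a b c i j k := fun x y z => by
    refine ⟨fun i => (x 0 - x₀ 0) * trace₁ T i + (y 0 - y₀ 0) * trace₂ T i
        + (z 0 - z₀ 0) * trace₃ T i,
      fun i => (x 1 - x₀ 1) * trace₁ T i + (y 1 - y₀ 1) * trace₂ T i
        + (z 1 - z₀ 1) * trace₃ T i,
      fun i => (x 2 - x₀ 2) * trace₁ T i + (y 2 - y₀ 2) * trace₂ T i
        + (z 2 - z₀ 2) * trace₃ T i, ?_⟩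
    funext i j k
    simp only [hC, competitor, pureTrace]
    ring
  constructor
  · rintro ⟨⟨x, y, z, hF⟩, hmin⟩
    obtain ⟨a, b, c, h⟩ := key x y z
    have hle := hmin x₀ y₀ z₀
    rw [hF, ← hC, h, normSq_add_pureTrace C h1 h2 h3] at hle
    have h0 : normSq (pureTrace a b c) = 0 :=
      le_antisymm (by linarith) (normSq_nonneg _)
    rw [hF, h]
    funext i j k
    rw [eq_zero_of_normSq_eq_zero h0, add_zero]
  · rintro rfl
    refine ⟨⟨x₀, y₀, z₀, hC⟩, fun x y z => ?_⟩
    obtain ⟨a, b, c, h⟩ := key x y z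
    rw [h, normSq_add_pureTrace F h1 h2 h3]
    linarith [normSq_nonneg (pureTrace a b c)]

/-- The algebraic core: if `T_{ijk} = P_{ikj} - P_{ijk}` where `P` is symmetric in its first two
indices and satisfies the contracted Bianchi identity `∑ l, P_{ill} = s_i / 2`, `s_i = ∑ l, P_{lli}`,
then the unique minimal norm tensor is the Cotton tensor. -/
theorem isMinimalNormTensor_iff_of_contracted_bianchi (hn : 2 ≤ n)
    {T P F : Fin n → Fin n → Fin n → ℝ} {s : Fin n → ℝ}
    (hT : ∀ i j k, T i j k = P i k j - P i j k) (hsymm : ∀ i j k, P i j k = P j i k)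
    (hs : ∀ i, s i = ∑ l, P l l i) (hdiv : ∀ i, 2 * ∑ l, P i l l = s i) :
    IsMinimalNormTensor T F ↔ F = fun i j k => P i k j - P i j k
      - 1 / (2 * ((n : ℝ) - 1)) * (s j * kron i k - s k * kron i j) := by
  have hn' : (n : ℝ) - 1 ≠ 0 := by
    have : (2 : ℝ) ≤ n := by exact_mod_cast hn
    linarith
  have t1 : trace₁ T = 0 := by
    funext i
    simp [trace₁, hT]
  have t2 : ∀ i, trace₂ T i = s i / 2 := fun i => by
    have : ∑ l, P l i l = ∑ l, P i l l := Finset.sum_congr rfl fun l _ => hsymm _ _ _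
    simp only [trace₂, hT, Finset.sum_sub_distrib, ← hs, this]
    linarith [hdiv i]
  have t3 : ∀ i, trace₃ T i = - (s i / 2) := fun i => by
    have : ∑ l, P l i l = ∑ l, P i l l := Finset.sum_congr rfl fun l _ => hsymm _ _ _
    simp only [trace₃, hT, Finset.sum_sub_distrib, ← hs, this]
    linarith [hdiv i]
  have hkk : ∑ l : Fin n, kron l l = n := by simp [kron]
  set c : ℝ := 1 / (2 * ((n : ℝ) - 1)) with hc
  -- This relation is what makes the second and third traces vanish: the correction contributes `c *
  -- (n - 1) * s i`, which must equal `s i / 2`.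
  have hcn : c * n = c + 1 / 2 := by
    rw [hc]; field_simp; ring
  have e2 : ∀ i, ∑ l, s l * kron l i = s i := fun i => by simp [kron]
  have hTC : ∀ i j k, P i k j - P i j k - c * (s j * kron i k - s k * kron i j)
      = T i j k - c * (s j * kron i k - s k * kron i j) := fun i j k => by rw [hT]
  simp only [hTC]
  -- Since `trace₂ T = s / 2`, the weights `-(2 * c)` and `2 * c` produce the terms `-c * s j * kron
  -- i k` and `c * s k * kron i j`.
  refine isMinimalNormTensor_iff_of_trace_eq_zero (x₀ := 0) (y₀ := ![0, -(2 * c), 2 * c])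
    (z₀ := 0) ?_ ?_ ?_ ?_
  · funext i j k
    simp [competitor, t2]
    ring
  · funext i
    have : trace₁ T i = 0 := congrFun t1 i
    simp only [trace₁] at this ⊢
    simp [this]
  · funext i
    have := t2 i
    simp only [trace₂] at this ⊢
    simp only [Finset.sum_sub_distrib, ← Finset.mul_sum, this, hkk, e2, Pi.zero_apply]
    linear_combination (-s i) * hcn
  · funext i
    have := t3 i
    simp only [trace₃] at this ⊢
    simp only [Finset.sum_sub_distrib, ← Finset.mul_sum, this, hkk, e2, Pi.zero_apply]
    linear_combination (s i) * hcn

end MinimalNorm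

/-! ### Partial derivatives of functions and of matrix fields. -/

section Calculus

variable {n : ℕ} {U : Set (EuclideanSpace ℝ (Fin n))} {y : EuclideanSpace ℝ (Fin n)}
  {f g : EuclideanSpace ℝ (Fin n) → ℝ}

lemma _root_.ContDiffOn.differentiableAt_of_isOpen (hf : ContDiffOn ℝ ∞ f U) (hU : IsOpen U)
    (hy : y ∈ U) : DifferentiableAt ℝ f y :=
  (hf.contDiffAt (hU.mem_nhds hy)).differentiableAt (by simp)

lemma contDiffOn_pderiv (hf : ContDiffOn ℝ ∞ f U) (hU : IsOpen U) (a : Fin n) :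
    ContDiffOn ℝ ∞ (pderiv a f) U :=
  (hf.fderiv_of_isOpen hU (by simp)).clm_apply contDiffOn_const

lemma pderiv_add (hf : DifferentiableAt ℝ f y) (hg : DifferentiableAt ℝ g y) (a : Fin n) :
    pderiv a (fun u => f u + g u) y = pderiv a f y + pderiv a g y := by
  simp [pderiv, fderiv_fun_add hf hg]

lemma pderiv_sub (hf : DifferentiableAt ℝ f y) (hg : DifferentiableAt ℝ g y) (a : Fin n) :
    pderiv a (fun u => f u - g u) y = pderiv a f y - pderiv a g y := by
  simp [pderiv, fderiv_fun_sub hf hg]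

lemma pderiv_neg (a : Fin n) : pderiv a (fun u => - f u) y = - pderiv a f y := by
  simp [pderiv, fderiv_fun_neg]

lemma pderiv_mul (hf : DifferentiableAt ℝ f y) (hg : DifferentiableAt ℝ g y) (a : Fin n) :
    pderiv a (fun u => f u * g u) y = pderiv a f y * g y + f y * pderiv a g y := by
  simp [pderiv, fderiv_fun_mul hf hg]
  ring

lemma pderiv_sum {ι : Type*} {s : Finset ι} {f : ι → EuclideanSpace ℝ (Fin n) → ℝ}
    (hf : ∀ i ∈ s, DifferentiableAt ℝ (f i) y) (a : Fin n) :
    pderiv a (fun u => ∑ i ∈ s, f i u) y = ∑ i ∈ s, pderiv a (f i) y := by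
  simp [pderiv, fderiv_fun_sum hf]

lemma pderiv_const (c : ℝ) (a : Fin n) : pderiv a (fun _ => c) y = 0 := by
  simp [pderiv]

lemma pderiv_congr (hU : IsOpen U) (hy : y ∈ U) (h : ∀ u ∈ U, f u = g u) (a : Fin n) :
    pderiv a f y = pderiv a g y := by
  have : f =ᶠ[nhds y] g := Filter.eventuallyEq_of_mem (hU.mem_nhds hy) h
  rw [pderiv, pderiv, this.fderiv_eq]

lemma pderiv_comm (hf : ContDiffOn ℝ ∞ f U) (hU : IsOpen U) (hy : y ∈ U) (a b : Fin n) :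
    pderiv a (pderiv b f) y = pderiv b (pderiv a f) y := by
  have hfy := hf.contDiffAt (hU.mem_nhds hy)
  have hd : DifferentiableAt ℝ (fderiv ℝ f) y :=
    (hfy.fderiv_right (m := 1) (by norm_cast)).differentiableAt (by simp)
  have hsymm : IsSymmSndFDerivAt ℝ f y := hfy.isSymmSndFDerivAt (by simp; norm_cast)
  have key : ∀ a b : Fin n, pderiv a (pderiv b f) y =
      fderiv ℝ (fderiv ℝ f) y (EuclideanSpace.single a 1) (EuclideanSpace.single b 1) := by
    intro a b
    have : pderiv b f = fun u => fderiv ℝ f u (EuclideanSpace.single b 1) := rfl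
    rw [this, pderiv, fderiv_clm_apply hd (differentiableAt_const _)]
    simp
  rw [key, key, hsymm.eq]

/-- Smoothness on a set of all entries of a matrix-valued function. -/
def SmoothMatrixOn (A : EuclideanSpace ℝ (Fin n) → Matrix (Fin n) (Fin n) ℝ)
    (U : Set (EuclideanSpace ℝ (Fin n))) : Prop :=
  ∀ i j, ContDiffOn ℝ ∞ (fun u => A u i j) U

/-- The entrywise partial derivative of a matrix-valued function. -/
def matrixPderiv (a : Fin n) (A : EuclideanSpace ℝ (Fin n) → Matrix (Fin n) (Fin n) ℝ)
    (y : EuclideanSpace ℝ (Fin n)) : Matrix (Fin n) (Fin n) ℝ :=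
  Matrix.of fun i j => pderiv a (fun u => A u i j) y

variable {A B : EuclideanSpace ℝ (Fin n) → Matrix (Fin n) (Fin n) ℝ}

lemma SmoothMatrixOn.matrixPderiv (hA : SmoothMatrixOn A U) (hU : IsOpen U) (a : Fin n) :
    SmoothMatrixOn (matrixPderiv a A) U :=
  fun i j => contDiffOn_pderiv (hA i j) hU a

lemma SmoothMatrixOn.mul (hA : SmoothMatrixOn A U) (hB : SmoothMatrixOn B U) :
    SmoothMatrixOn (fun u => A u * B u) U := fun i j => by
  simp only [Matrix.mul_apply]
  exact ContDiffOn.sum fun k _ => (hA i k).mul (hB k j)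

lemma SmoothMatrixOn.add (hA : SmoothMatrixOn A U) (hB : SmoothMatrixOn B U) :
    SmoothMatrixOn (fun u => A u + B u) U := fun i j => (hA i j).add (hB i j)

lemma SmoothMatrixOn.sub (hA : SmoothMatrixOn A U) (hB : SmoothMatrixOn B U) :
    SmoothMatrixOn (fun u => A u - B u) U := fun i j => (hA i j).sub (hB i j)

lemma SmoothMatrixOn.transpose (hA : SmoothMatrixOn A U) :
    SmoothMatrixOn (fun u => (A u).transpose) U := fun i j => hA j i

lemma SmoothMatrixOn.contDiffOn_det (hA : SmoothMatrixOn A U) :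
    ContDiffOn ℝ ∞ (fun u => (A u).det) U := by
  simp only [Matrix.det_apply]
  exact ContDiffOn.sum fun σ _ => (contDiffOn_prod fun i _ => hA _ _).const_smul _

/-- Cramer's rule: an entry of the inverse is an adjugate entry over the determinant, and an
adjugate entry is the determinant of the matrix with one row made constant. -/
lemma SmoothMatrixOn.inv (hA : SmoothMatrixOn A U) (hdet : ∀ u ∈ U, IsUnit (A u).det) :
    SmoothMatrixOn (fun u => (A u)⁻¹) U := fun i j => by
  simp only [Matrix.inv_def, Matrix.smul_apply, smul_eq_mul, Ring.inverse_eq_inv']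
  refine (hA.contDiffOn_det.inv fun u hu => (hdet u hu).ne_zero).mul ?_
  simp only [Matrix.adjugate_apply]
  refine SmoothMatrixOn.contDiffOn_det (A := fun u => (A u).updateRow j (Pi.single i 1))
    fun k l => ?_
  by_cases hk : k = j
  · subst hk
    simpa using contDiffOn_const
  · simpa [Matrix.updateRow_ne hk] using hA k l

lemma SmoothMatrixOn.differentiableAt (hA : SmoothMatrixOn A U) (hU : IsOpen U) (hy : y ∈ U)
    (i j : Fin n) : DifferentiableAt ℝ (fun u => A u i j) y :=
  (hA i j).differentiableAt_of_isOpen hU hy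

lemma matrixPderiv_mul (hA : SmoothMatrixOn A U) (hB : SmoothMatrixOn B U) (hU : IsOpen U)
    (hy : y ∈ U) (a : Fin n) :
    matrixPderiv a (fun u => A u * B u) y =
      matrixPderiv a A y * B y + A y * matrixPderiv a B y := by
  ext i j
  simp only [matrixPderiv, Matrix.of_apply, Matrix.add_apply, Matrix.mul_apply]
  rw [pderiv_sum fun k _ => DifferentiableAt.fun_mul (hA.differentiableAt hU hy i k)
    (hB.differentiableAt hU hy k j), ← Finset.sum_add_distrib]
  exact Finset.sum_congr rfl fun k _ =>
    pderiv_mul (hA.differentiableAt hU hy i k) (hB.differentiableAt hU hy k j) a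

lemma matrixPderiv_add (hA : SmoothMatrixOn A U) (hB : SmoothMatrixOn B U) (hU : IsOpen U)
    (hy : y ∈ U) (a : Fin n) :
    matrixPderiv a (fun u => A u + B u) y = matrixPderiv a A y + matrixPderiv a B y := by
  ext i j
  exact pderiv_add (hA.differentiableAt hU hy i j) (hB.differentiableAt hU hy i j) a

lemma matrixPderiv_sub (hA : SmoothMatrixOn A U) (hB : SmoothMatrixOn B U) (hU : IsOpen U)
    (hy : y ∈ U) (a : Fin n) :
    matrixPderiv a (fun u => A u - B u) y = matrixPderiv a A y - matrixPderiv a B y := by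
  ext i j
  exact pderiv_sub (hA.differentiableAt hU hy i j) (hB.differentiableAt hU hy i j) a

lemma matrixPderiv_transpose (a : Fin n) :
    matrixPderiv a (fun u => (A u).transpose) y = (matrixPderiv a A y).transpose := rfl

lemma matrixPderiv_congr (hU : IsOpen U) (hy : y ∈ U) (h : ∀ u ∈ U, A u = B u) (a : Fin n) :
    matrixPderiv a A y = matrixPderiv a B y := by
  ext i j
  exact pderiv_congr hU hy (fun u hu => by rw [h u hu]) a

lemma matrixPderiv_comm (hA : SmoothMatrixOn A U) (hU : IsOpen U) (hy : y ∈ U) (a b : Fin n) :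
    matrixPderiv a (matrixPderiv b A) y = matrixPderiv b (matrixPderiv a A) y := by
  ext i j
  exact pderiv_comm (hA i j) hU hy a b

end Calculus

/-! ### Symmetries of the curvature and the Bianchi identities in coordinates. -/

section Curvature

variable {n : ℕ} {G : EuclideanSpace ℝ (Fin n) → Matrix (Fin n) (Fin n) ℝ}
  {U : Set (EuclideanSpace ℝ (Fin n))} {y : EuclideanSpace ℝ (Fin n)}

/-- `G` is a smooth field of invertible symmetric matrices on the open set `U`. -/
structure IsSmoothMetricOn (G : EuclideanSpace ℝ (Fin n) → Matrix (Fin n) (Fin n) ℝ)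
    (U : Set (EuclideanSpace ℝ (Fin n))) : Prop where
  isOpen : IsOpen U
  smooth : SmoothMatrixOn G U
  transpose_eq : ∀ u, (G u).transpose = G u
  isUnit_det : ∀ u ∈ U, IsUnit (G u).det

/-- The connection matrix in the direction `∂_m`, with entries `Γ^c_{mb}`. -/
def connMatrix (G : EuclideanSpace ℝ (Fin n) → Matrix (Fin n) (Fin n) ℝ) (m : Fin n)
    (y : EuclideanSpace ℝ (Fin n)) : Matrix (Fin n) (Fin n) ℝ :=
  Matrix.of fun c b => christoffel G c m b y

/-- The matrix of the curvature endomorphism `R(∂_a, ∂_b)`. -/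
def curvMatrix (G : EuclideanSpace ℝ (Fin n) → Matrix (Fin n) (Fin n) ℝ) (a b : Fin n)
    (y : EuclideanSpace ℝ (Fin n)) : Matrix (Fin n) (Fin n) ℝ :=
  Matrix.of fun d c => curvature G d c a b y

lemma connMatrix_apply (m c b : Fin n) : connMatrix G m y c b = christoffel G c m b y := rfl

lemma curvMatrix_eq (a b : Fin n) : curvMatrix G a b y =
    matrixPderiv a (connMatrix G b) y - matrixPderiv b (connMatrix G a) y
      + (connMatrix G a y * connMatrix G b y - connMatrix G b y * connMatrix G a y) := by
  ext d c
  simp [curvMatrix, curvature, matrixPderiv, connMatrix, Matrix.mul_apply]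

lemma curvMatrix_swap (a b : Fin n) : curvMatrix G b a y = - curvMatrix G a b y := by
  rw [curvMatrix_eq, curvMatrix_eq]
  abel

lemma riemann_eq (a b c d : Fin n) :
    riemann G y ![a, b, c, d] = (G y * curvMatrix G c d y) a b := rfl

namespace IsSmoothMetricOn

lemma apply_comm (hG : IsSmoothMetricOn G U) (u : EuclideanSpace ℝ (Fin n)) (a b : Fin n) :
    G u a b = G u b a := congrFun (congrFun (hG.transpose_eq u) b) a

/-- The connection is torsion-free. Symmetry of `G` holds at every point, so the entry functions
themselves agree and may be swapped under `pderiv`. -/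
lemma christoffel_comm (hG : IsSmoothMetricOn G U) (c a b : Fin n) :
    christoffel G c a b = christoffel G c b a := by
  funext y
  simp only [christoffel]
  congr 1
  refine Finset.sum_congr rfl fun d _ => ?_
  rw [show (fun u => G u a b) = fun u => G u b a from funext fun u => hG.apply_comm u a b]
  ring

lemma smooth_connMatrix (hG : IsSmoothMetricOn G U) (m : Fin n) :
    SmoothMatrixOn (connMatrix G m) U := by
  intro c b
  simp only [connMatrix_apply, christoffel]
  refine contDiffOn_const.mul (ContDiffOn.sum fun d _ => ?_)
  exact (hG.smooth.inv hG.isUnit_det c d).mul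
    (((contDiffOn_pderiv (hG.smooth b d) hG.isOpen m).add
      (contDiffOn_pderiv (hG.smooth m d) hG.isOpen b)).sub
      (contDiffOn_pderiv (hG.smooth m b) hG.isOpen d))

lemma smooth_curvMatrix (hG : IsSmoothMetricOn G U) (a b : Fin n) :
    SmoothMatrixOn (curvMatrix G a b) U := by
  rw [show curvMatrix G a b = _ from funext fun _ => curvMatrix_eq a b]
  have ha := hG.smooth_connMatrix a
  have hb := hG.smooth_connMatrix b
  exact ((hb.matrixPderiv hG.isOpen a).sub (ha.matrixPderiv hG.isOpen b)).add
    ((ha.mul hb).sub (hb.mul ha))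

/-- Christoffel symbols of the first kind: multiplying by `G` cancels the inverse metric in
`christoffel`. -/
lemma mul_connMatrix_apply (hG : IsSmoothMetricOn G U) (hy : y ∈ U) (m a b : Fin n) :
    (G y * connMatrix G m y) a b = 1 / 2 * (pderiv m (fun u => G u b a) y
      + pderiv b (fun u => G u m a) y - pderiv a (fun u => G u m b) y) := by
  have h : connMatrix G m y = (G y)⁻¹ * Matrix.of fun d b => 1 / 2 *
      (pderiv m (fun u => G u b d) y + pderiv b (fun u => G u m d) y
        - pderiv d (fun u => G u m b) y) := by
    ext c b
    simp only [connMatrix_apply, christoffel, Matrix.mul_apply, Matrix.of_apply, Finset.mul_sum]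
    exact Finset.sum_congr rfl fun d _ => by ring
  rw [h, Matrix.mul_nonsing_inv_cancel_left _ _ (hG.isUnit_det y hy), Matrix.of_apply]

/-- Compatibility of the Levi-Civita connection with the metric. -/
lemma matrixPderiv_metric (hG : IsSmoothMetricOn G U) (hy : y ∈ U) (m : Fin n) :
    matrixPderiv m G y = (connMatrix G m y).transpose * G y + G y * connMatrix G m y := by
  have h : (connMatrix G m y).transpose * G y = (G y * connMatrix G m y).transpose := by
    rw [Matrix.transpose_mul, hG.transpose_eq]
  ext a b
  rw [h, Matrix.add_apply, Matrix.transpose_apply, hG.mul_connMatrix_apply hy,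
    hG.mul_connMatrix_apply hy]
  simp only [matrixPderiv, Matrix.of_apply]
  rw [show (fun u => G u b a) = fun u => G u a b from funext fun u => hG.apply_comm u b a]
  ring

/-- Differentiate `G * G⁻¹ = 1`, insert metric compatibility and multiply on the left by `G⁻¹`. -/
lemma matrixPderiv_inv (hG : IsSmoothMetricOn G U) (hy : y ∈ U) (m : Fin n) :
    matrixPderiv m (fun u => (G u)⁻¹) y =
      - (connMatrix G m y * (G y)⁻¹ + (G y)⁻¹ * (connMatrix G m y).transpose) := by
  have hu := hG.isUnit_det y hy
  have h0 : matrixPderiv m (fun u => G u * (G u)⁻¹) y = 0 := by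
    rw [matrixPderiv_congr (B := fun _ => 1) hG.isOpen hy
      fun u hu => Matrix.mul_nonsing_inv _ (hG.isUnit_det u hu)]
    ext i j
    exact pderiv_const _ _
  rw [matrixPderiv_mul hG.smooth (hG.smooth.inv hG.isUnit_det) hG.isOpen hy,
    hG.matrixPderiv_metric hy] at h0
  have h1 := congrArg ((G y)⁻¹ * ·) h0
  simp only [mul_add, add_mul, mul_zero, Matrix.nonsing_inv_mul_cancel_left _ _ hu, mul_assoc,
    Matrix.mul_nonsing_inv _ hu, mul_one] at h1
  rw [eq_neg_iff_add_eq_zero, ← h1]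
  abel

/-- The curvature endomorphisms are skew-adjoint. -/
lemma transpose_mul_curvMatrix (hG : IsSmoothMetricOn G U) (hy : y ∈ U) (a b : Fin n) :
    (G y * curvMatrix G a b y).transpose = - (G y * curvMatrix G a b y) := by
  have hA := fun m => hG.smooth_connMatrix m
  have hAt := fun m => (hG.smooth_connMatrix m).transpose
  have second : ∀ a b, matrixPderiv a (matrixPderiv b G) y =
      ((matrixPderiv a (connMatrix G b) y).transpose * G y
        + (connMatrix G b y).transpose *
          ((connMatrix G a y).transpose * G y + G y * connMatrix G a y))
      + (((connMatrix G a y).transpose * G y + G y * connMatrix G a y) * connMatrix G b y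
        + G y * matrixPderiv a (connMatrix G b) y) := fun a b => by
    rw [matrixPderiv_congr hG.isOpen hy (fun u hu => hG.matrixPderiv_metric hu b),
      matrixPderiv_add ((hAt b).mul hG.smooth) (hG.smooth.mul (hA b)) hG.isOpen hy,
      matrixPderiv_mul (hAt b) hG.smooth hG.isOpen hy,
      matrixPderiv_mul hG.smooth (hA b) hG.isOpen hy, hG.matrixPderiv_metric hy,
      matrixPderiv_transpose]
  -- Second partials of `G` commute. Antisymmetrizing `second` in `a`, `b` leaves exactly the
  -- curvature term plus its transpose.
  have h := matrixPderiv_comm hG.smooth hG.isOpen hy a b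
  rw [second, second, ← sub_eq_zero] at h
  rw [eq_neg_iff_add_eq_zero, ← h, curvMatrix_eq, Matrix.transpose_mul, hG.transpose_eq]
  simp only [Matrix.transpose_add, Matrix.transpose_sub, Matrix.transpose_mul]
  noncomm_ring

lemma riemann_antisymm_left (hG : IsSmoothMetricOn G U) (hy : y ∈ U) (a b c d : Fin n) :
    riemann G y ![b, a, c, d] = - riemann G y ![a, b, c, d] := by
  rw [riemann_eq, riemann_eq]
  exact congrFun (congrFun (hG.transpose_mul_curvMatrix hy c d) a) b

end IsSmoothMetricOn

lemma riemann_antisymm_right (a b c d : Fin n) :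
    riemann G y ![a, b, d, c] = - riemann G y ![a, b, c, d] := by
  rw [riemann_eq, riemann_eq, curvMatrix_swap]
  simp

namespace IsSmoothMetricOn

/-- The first Bianchi identity. -/
lemma riemann_cyclic (hG : IsSmoothMetricOn G U) (a b c d : Fin n) :
    riemann G y ![a, b, c, d] + riemann G y ![a, c, d, b] + riemann G y ![a, d, b, c] = 0 := by
  have h : ∀ e, curvature G e b c d y + curvature G e c d b y + curvature G e d b c y = 0 := by
    intro e
    -- With the lower indices of the Christoffel symbols normalized, the cyclic sum cancels term by
    -- term.
    simp only [curvature, hG.christoffel_comm _ d c, hG.christoffel_comm _ b d,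
      hG.christoffel_comm _ c b, Finset.sum_sub_distrib]
    ring
  have hr : ∀ b c d, riemann G y ![a, b, c, d] = ∑ e, G y a e * curvature G e b c d y :=
    fun _ _ _ => rfl
  simp only [hr, ← Finset.sum_add_distrib, ← mul_add, h, mul_zero, Finset.sum_const_zero]

/-- The classical combination of four cyclic identities, one for each choice of first index, with
the two antisymmetries. -/
lemma riemann_pair_symm (hG : IsSmoothMetricOn G U) (hy : y ∈ U) (a b c d : Fin n) :
    riemann G y ![c, d, a, b] = riemann G y ![a, b, c, d] := by
  have h1 := hG.riemann_cyclic (y := y) a b c d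
  have h2 := hG.riemann_cyclic (y := y) b c d a
  have h3 := hG.riemann_cyclic (y := y) c d a b
  have h4 := hG.riemann_cyclic (y := y) d a b c
  have l := fun a b c d => hG.riemann_antisymm_left hy a b c d
  have r := fun a b c d => riemann_antisymm_right (G := G) (y := y) a b c d
  linarith [l a b c d, l a c d b, l a d b c, l b c d a, l b d a c, l c d a b,
    r a b c d, r a c d b, r a d b c, r b a c d, r b c d a, r b d a c, r c a d b, r c d a b,
    r c b d a, r d a b c, r d b a c, r d c a b]

lemma contDiffOn_riemann (hG : IsSmoothMetricOn G U) (a b c d : Fin n) :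
    ContDiffOn ℝ ∞ (fun u => riemann G u ![a, b, c, d]) U :=
  (hG.smooth.mul (hG.smooth_curvMatrix c d)) a b

lemma contDiffOn_ricci (hG : IsSmoothMetricOn G U) (a b : Fin n) :
    ContDiffOn ℝ ∞ (fun u => ricci G u ![a, b]) U :=
  ContDiffOn.sum fun _ _ => ContDiffOn.sum fun _ _ =>
    (hG.smooth.inv hG.isUnit_det _ _).mul (hG.contDiffOn_riemann _ _ _ _)

end IsSmoothMetricOn

lemma covDeriv_zero (S : EuclideanSpace ℝ (Fin n) → (Fin 0 → Fin n) → ℝ) (m : Fin n)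
    (y : EuclideanSpace ℝ (Fin n)) : covDeriv G S m y ![] = pderiv m (fun u => S u ![]) y := by
  simp [covDeriv]

lemma covDeriv_two (S : EuclideanSpace ℝ (Fin n) → (Fin 2 → Fin n) → ℝ) (m : Fin n)
    (y : EuclideanSpace ℝ (Fin n)) (a b : Fin n) : covDeriv G S m y ![a, b] =
      pderiv m (fun u => S u ![a, b]) y - ∑ e, christoffel G e m a y * S y ![e, b]
        - ∑ e, christoffel G e m b y * S y ![a, e] := by
  have h0 : ∀ e, Function.update ![a, b] 0 e = ![e, b] := fun e => by
    funext i; fin_cases i <;> rfl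
  have h1 : ∀ e, Function.update ![a, b] 1 e = ![a, e] := fun e => by
    funext i; fin_cases i <;> rfl
  simp only [covDeriv, Fin.sum_univ_two, h0, h1]
  simp
  ring

lemma covDeriv_four (S : EuclideanSpace ℝ (Fin n) → (Fin 4 → Fin n) → ℝ) (m : Fin n)
    (y : EuclideanSpace ℝ (Fin n)) (a b c d : Fin n) : covDeriv G S m y ![a, b, c, d] =
      pderiv m (fun u => S u ![a, b, c, d]) y
        - ∑ e, christoffel G e m a y * S y ![e, b, c, d]
        - ∑ e, christoffel G e m b y * S y ![a, e, c, d]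
        - ∑ e, christoffel G e m c y * S y ![a, b, e, d]
        - ∑ e, christoffel G e m d y * S y ![a, b, c, e] := by
  have h0 : ∀ e, Function.update ![a, b, c, d] 0 e = ![e, b, c, d] := fun e => by
    funext i; fin_cases i <;> rfl
  have h1 : ∀ e, Function.update ![a, b, c, d] 1 e = ![a, e, c, d] := fun e => by
    funext i; fin_cases i <;> rfl
  have h2 : ∀ e, Function.update ![a, b, c, d] 2 e = ![a, b, e, d] := fun e => by
    funext i; fin_cases i <;> rfl
  have h3 : ∀ e, Function.update ![a, b, c, d] 3 e = ![a, b, c, e] := fun e => by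
    funext i; fin_cases i <;> rfl
  simp only [covDeriv, Fin.sum_univ_four, h0, h1, h2, h3]
  simp
  ring

namespace IsSmoothMetricOn

/-- Pair symmetry holds throughout the open set `U`, so it can be differentiated; the Christoffel
terms are permuted by the same symmetry. -/
lemma covDeriv_riemann_pair_symm (hG : IsSmoothMetricOn G U) (hy : y ∈ U)
    (m a b c d : Fin n) :
    covDeriv G (riemann G) m y ![c, d, a, b] = covDeriv G (riemann G) m y ![a, b, c, d] := by
  rw [covDeriv_four, covDeriv_four,
    pderiv_congr hG.isOpen hy (fun u hu => hG.riemann_pair_symm hu a b c d)]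
  simp only [fun e => hG.riemann_pair_symm hy a b e d, fun e => hG.riemann_pair_symm hy a b c e,
    fun e => hG.riemann_pair_symm hy e b c d, fun e => hG.riemann_pair_symm hy a e c d]
  ring

/-- The differential Bianchi identity for the curvature endomorphisms. -/
lemma curvMatrix_bianchi (hG : IsSmoothMetricOn G U) (hy : y ∈ U) (m c d : Fin n) :
    let D := fun m c d => matrixPderiv m (curvMatrix G c d) y
      + connMatrix G m y * curvMatrix G c d y - curvMatrix G c d y * connMatrix G m y
    D m c d + D c d m + D d m c = 0 := by
  intro D
  have hA := fun m => hG.smooth_connMatrix m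
  have hdA := fun m k => (hG.smooth_connMatrix m).matrixPderiv hG.isOpen k
  have hD : ∀ m c d, matrixPderiv m (curvMatrix G c d) y =
      matrixPderiv m (matrixPderiv c (connMatrix G d)) y
      - matrixPderiv m (matrixPderiv d (connMatrix G c)) y
      + ((matrixPderiv m (connMatrix G c) y * connMatrix G d y
          + connMatrix G c y * matrixPderiv m (connMatrix G d) y)
        - (matrixPderiv m (connMatrix G d) y * connMatrix G c y
          + connMatrix G d y * matrixPderiv m (connMatrix G c) y)) := fun m c d => by
    rw [show curvMatrix G c d = _ from funext fun _ => curvMatrix_eq c d,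
      matrixPderiv_add ((hdA d c).sub (hdA c d)) (((hA c).mul (hA d)).sub ((hA d).mul (hA c)))
        hG.isOpen hy, matrixPderiv_sub (hdA d c) (hdA c d) hG.isOpen hy,
      matrixPderiv_sub ((hA c).mul (hA d)) ((hA d).mul (hA c)) hG.isOpen hy,
      matrixPderiv_mul (hA c) (hA d) hG.isOpen hy, matrixPderiv_mul (hA d) (hA c) hG.isOpen hy]
  simp only [D, hD, curvMatrix_eq]
  -- Second derivatives of the connection matrices cancel by commutation of partials, products of a
  -- matrix with a first derivative cancel in pairs, and the cubic terms cancel by the Jacobi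
  -- identity.
  rw [matrixPderiv_comm (hA d) hG.isOpen hy c m, matrixPderiv_comm (hA c) hG.isOpen hy d m,
    matrixPderiv_comm (hA m) hG.isOpen hy d c]
  noncomm_ring

/-- The covariant derivative of the curvature in terms of curvature endomorphisms. -/
lemma covDeriv_riemann_eq (hG : IsSmoothMetricOn G U) (hy : y ∈ U) (m a b c d : Fin n) :
    covDeriv G (riemann G) m y ![a, b, c, d] =
      (G y * (matrixPderiv m (curvMatrix G c d) y
        + connMatrix G m y * curvMatrix G c d y - curvMatrix G c d y * connMatrix G m y)) a b
      - ∑ e, christoffel G e m c y * riemann G y ![a, b, e, d]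
      - ∑ e, christoffel G e m d y * riemann G y ![a, b, c, e] := by
  have h1 : pderiv m (fun u => riemann G u ![a, b, c, d]) y =
      (matrixPderiv m (fun u => G u * curvMatrix G c d u) y) a b := rfl
  have h2 : ∑ e, christoffel G e m a y * riemann G y ![e, b, c, d] =
      ((connMatrix G m y).transpose * (G y * curvMatrix G c d y)) a b := by
    rw [Matrix.mul_apply]; rfl
  have h3 : ∑ e, christoffel G e m b y * riemann G y ![a, e, c, d] =
      ((G y * curvMatrix G c d y) * connMatrix G m y) a b := by
    rw [Matrix.mul_apply]
    exact Finset.sum_congr rfl fun e _ => mul_comm _ _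
  rw [covDeriv_four, h1, h2, h3, ← Matrix.sub_apply, ← Matrix.sub_apply,
    matrixPderiv_mul hG.smooth (hG.smooth_curvMatrix c d) hG.isOpen hy, hG.matrixPderiv_metric hy]
  congr 3
  noncomm_ring

/-- The second Bianchi identity. -/
theorem covDeriv_riemann_bianchi (hG : IsSmoothMetricOn G U) (hy : y ∈ U) (m a b c d : Fin n) :
    covDeriv G (riemann G) m y ![a, b, c, d] + covDeriv G (riemann G) c y ![a, b, d, m]
      + covDeriv G (riemann G) d y ![a, b, m, c] = 0 := by
  have h := congrArg (fun X => (G y * X) a b) (hG.curvMatrix_bianchi hy m c d)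
  simp only [mul_add, Matrix.add_apply, mul_zero, Matrix.zero_apply] at h
  rw [hG.covDeriv_riemann_eq hy, hG.covDeriv_riemann_eq hy, hG.covDeriv_riemann_eq hy]
  -- The Christoffel terms in the last two slots cancel in pairs over the cyclic sum: the symbol is
  -- symmetric in its lower indices, the curvature antisymmetric in its last two.
  have s : ∀ p q f, ∑ e, christoffel G e p q y * riemann G y ![a, b, f, e] =
      - ∑ e, christoffel G e q p y * riemann G y ![a, b, e, f] := fun p q f => by
    rw [← Finset.sum_neg_distrib]
    refine Finset.sum_congr rfl fun e _ => ?_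
    rw [riemann_antisymm_right a b e f, hG.christoffel_comm e p q, mul_neg]
  rw [s m d c, s c m d, s d c m]
  simp only [mul_add, mul_sub, Matrix.add_apply, Matrix.sub_apply] at h ⊢
  linarith

/-- Contraction with the inverse metric commutes with covariant differentiation. -/
lemma pderiv_contract (hG : IsSmoothMetricOn G U) (hy : y ∈ U) (m : Fin n)
    {X : EuclideanSpace ℝ (Fin n) → Matrix (Fin n) (Fin n) ℝ} (hX : SmoothMatrixOn X U) :
    pderiv m (fun u => ∑ c, ∑ d, (G u)⁻¹ c d * X u c d) y =
      ∑ c, ∑ d, (G y)⁻¹ c d * (pderiv m (fun u => X u c d) y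
        - ∑ e, christoffel G e m c y * X y e d - ∑ e, christoffel G e m d y * X y c e) := by
  have hI := hG.smooth.inv hG.isUnit_det
  have hdI := fun c d => hI.differentiableAt hG.isOpen hy c d
  have hdX := fun c d => hX.differentiableAt hG.isOpen hy c d
  have hp : ∀ c d, pderiv m (fun u => (G u)⁻¹ c d) y =
      - (∑ e, christoffel G c m e y * (G y)⁻¹ e d + ∑ e, (G y)⁻¹ c e * christoffel G d m e y) :=
    fun c d => congrFun (congrFun (hG.matrixPderiv_inv hy m) c) d
  rw [pderiv_sum fun c _ => DifferentiableAt.fun_sum fun d _ => (hdI c d).fun_mul (hdX c d)]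
  simp only [fun c => pderiv_sum (fun d (_ : d ∈ Finset.univ) => (hdI c d).fun_mul (hdX c d)) m,
    fun c d => pderiv_mul (hdI c d) (hdX c d) m, hp, mul_sub, neg_mul, add_mul, Finset.sum_mul,
    Finset.mul_sum, Finset.sum_add_distrib, Finset.sum_sub_distrib, Finset.sum_neg_distrib]
  -- Renaming summation indices moves each Christoffel symbol from the derivative of the inverse
  -- metric onto a slot of `X`.
  have t1 : ∑ c, ∑ d, ∑ e, christoffel G c m e y * (G y)⁻¹ e d * X y c d =
      ∑ c, ∑ d, ∑ e, (G y)⁻¹ c d * (christoffel G e m c y * X y e d) := by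
    rw [Finset.sum_comm]
    conv_rhs => rw [Finset.sum_comm]
    refine Finset.sum_congr rfl fun d _ => ?_
    rw [Finset.sum_comm]
    exact Finset.sum_congr rfl fun c _ => Finset.sum_congr rfl fun e _ => by ring
  have t2 : ∑ c, ∑ d, ∑ e, (G y)⁻¹ c e * christoffel G d m e y * X y c d =
      ∑ c, ∑ d, ∑ e, (G y)⁻¹ c d * (christoffel G e m d y * X y c e) := by
    refine Finset.sum_congr rfl fun c _ => ?_
    rw [Finset.sum_comm]
    exact Finset.sum_congr rfl fun c _ => Finset.sum_congr rfl fun e _ => by ring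
  rw [t1, t2]
  ring

/-- `pderiv_contract` supplies the Christoffel terms of the two contracted slots, `covDeriv_two`
those of the two free slots; together they are the four terms of `covDeriv_four`. -/
lemma covDeriv_ricci (hG : IsSmoothMetricOn G U) (hy : y ∈ U) (m a b : Fin n) :
    covDeriv G (ricci G) m y ![a, b] =
      ∑ c, ∑ d, (G y)⁻¹ c d * covDeriv G (riemann G) m y ![c, a, d, b] := by
  have hr : ∀ u a b, ricci G u ![a, b] = ∑ c, ∑ d, (G u)⁻¹ c d * riemann G u ![c, a, d, b] :=
    fun _ _ _ => rfl
  have h := hG.pderiv_contract hy m (X := fun u => Matrix.of fun c d => riemann G u ![c, a, d, b])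
    fun c d => hG.contDiffOn_riemann c a d b
  simp only [Matrix.of_apply] at h
  have t : ∀ (f : Fin n → ℝ) (X : Fin n → Fin n → Fin n → ℝ),
      ∑ e, f e * ∑ c, ∑ d, (G y)⁻¹ c d * X e c d =
        ∑ c, ∑ d, (G y)⁻¹ c d * ∑ e, f e * X e c d := fun f X => by
    simp only [Finset.mul_sum]
    rw [Finset.sum_comm]
    refine Finset.sum_congr rfl fun c _ => ?_
    rw [Finset.sum_comm]
    exact Finset.sum_congr rfl fun d _ => Finset.sum_congr rfl fun e _ => by ring
  rw [covDeriv_two]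
  simp only [hr]
  rw [h, t, t]
  simp only [← Finset.sum_sub_distrib, ← mul_sub, covDeriv_four]
  refine Finset.sum_congr rfl fun c _ => Finset.sum_congr rfl fun d _ => by ring

lemma covDeriv_scalarCurvature (hG : IsSmoothMetricOn G U) (hy : y ∈ U) (m : Fin n) :
    covDeriv G (scalarCurvature G) m y ![] =
      ∑ a, ∑ b, (G y)⁻¹ a b * covDeriv G (ricci G) m y ![a, b] := by
  rw [covDeriv_zero]
  simp only [covDeriv_two]
  exact hG.pderiv_contract hy m (X := fun u => Matrix.of fun c d => ricci G u ![c, d])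
    fun c d => hG.contDiffOn_ricci c d

end IsSmoothMetricOn

lemma covDeriv_riemann_antisymm_right (m a b c d : Fin n) :
    covDeriv G (riemann G) m y ![a, b, d, c] = - covDeriv G (riemann G) m y ![a, b, c, d] := by
  have h : ∀ u a b, riemann G u ![a, b, d, c] = - riemann G u ![a, b, c, d] :=
    fun u a b => riemann_antisymm_right a b c d
  rw [covDeriv_four, covDeriv_four]
  simp only [h, pderiv_neg, fun e => riemann_antisymm_right (G := G) (y := y) a b e d,
    fun e => riemann_antisymm_right (G := G) (y := y) a b c e, mul_neg, Finset.sum_neg_distrib]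
  ring

lemma IsSmoothMetricOn.covDeriv_riemann_antisymm_both (hG : IsSmoothMetricOn G U) (hy : y ∈ U)
    (m a b c d : Fin n) :
    covDeriv G (riemann G) m y ![b, a, d, c] = covDeriv G (riemann G) m y ![a, b, c, d] := by
  rw [covDeriv_riemann_antisymm_right, ← hG.covDeriv_riemann_pair_symm hy,
    covDeriv_riemann_antisymm_right, hG.covDeriv_riemann_pair_symm hy, neg_neg]

end Curvature

/-! ### The metric in a chart: smoothness, nondegeneracy, frames. -/

section Manifold

open Bundle

variable {n : ℕ} {M : Type*} [TopologicalSpace M] [ChartedSpace (EuclideanSpace ℝ (Fin n)) M]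
  {φ : OpenPartialHomeomorph M (EuclideanSpace ℝ (Fin n))}

lemma mdifferentiable_of_mem_maximalAtlas (hφ : φ ∈ IsManifold.maximalAtlas (𝓡 n) ∞ M) :
    φ.MDifferentiable (𝓡 n) (𝓡 n) :=
  ⟨(contMDiffOn_of_mem_maximalAtlas hφ).mdifferentiableOn (by simp),
    (contMDiffOn_symm_of_mem_maximalAtlas hφ).mdifferentiableOn (by simp)⟩

variable [IsManifold (𝓡 n) ∞ M]

/-- The coordinate field is the tangent map of `φ.symm` composed with a constant vector field, hence
smooth. -/
lemma contMDiffOn_mfderiv_symm_apply (hφ : φ ∈ IsManifold.maximalAtlas (𝓡 n) ∞ M)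
    (v : EuclideanSpace ℝ (Fin n)) :
    ContMDiffOn (𝓡 n) (𝓡 n).tangent ∞
      (fun y => (TotalSpace.mk' (EuclideanSpace ℝ (Fin n)) (φ.symm y)
        (mfderiv (𝓡 n) (𝓡 n) φ.symm y v) : TangentBundle (𝓡 n) M)) φ.target := by
  have h1 := (contMDiffOn_symm_of_mem_maximalAtlas hφ).contMDiffOn_tangentMapWithin (m := ∞)
    (by simp) φ.open_target.uniqueMDiffOn
  have h2 : ContMDiff (𝓡 n) (𝓡 n).tangent ∞
      (fun y => (⟨y, v⟩ : TangentBundle (𝓡 n) (EuclideanSpace ℝ (Fin n)))) := by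
    exact contMDiff_vectorSpace_iff_contDiff.2 contDiff_const
  refine (h1.comp h2.contMDiffOn fun y hy => hy).congr fun y hy => ?_
  simp only [Function.comp, tangentMapWithin, mfderivWithin_of_isOpen φ.open_target hy]

lemma contDiffOn_chartMetric (g : Bundle.ContMDiffRiemannianMetric (𝓡 n) ∞
      (EuclideanSpace ℝ (Fin n)) (TangentSpace (𝓡 n) : M → Type _))
    (hφ : φ ∈ IsManifold.maximalAtlas (𝓡 n) ∞ M) (a b : Fin n) :
    ContDiffOn ℝ ∞ (fun y => chartMetric g φ y a b) φ.target := by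
  rw [← contMDiffOn_iff_contDiffOn]
  intro y hy
  -- The coefficient is viewed as a section of the trivial line bundle, where a smooth bilinear
  -- bundle form can be evaluated on smooth vector fields.
  have h : ContMDiffWithinAt (𝓡 n) ((𝓡 n).prod 𝓘(ℝ)) ∞
      (fun y => TotalSpace.mk' ℝ (E := Bundle.Trivial M ℝ) (φ.symm y) (chartMetric g φ y a b))
      φ.target y := by
    refine ContMDiffWithinAt.clm_bundle_apply₂ (E₃ := Bundle.Trivial M ℝ) (F₁ := EuclideanSpace ℝ (Fin n))
      (F₂ := EuclideanSpace ℝ (Fin n)) (ψ := fun y => g.inner (φ.symm y))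
      ?_ (contMDiffOn_mfderiv_symm_apply hφ _ y hy) (contMDiffOn_mfderiv_symm_apply hφ _ y hy)
    exact g.contMDiff.contMDiffAt.comp_contMDiffWithinAt y
      (contMDiffOn_symm_of_mem_maximalAtlas hφ y hy)
  simp only [contMDiffWithinAt_totalSpace] at h
  exact h.2

lemma chartMetric_symm (g : Bundle.ContMDiffRiemannianMetric (𝓡 n) ∞
      (EuclideanSpace ℝ (Fin n)) (TangentSpace (𝓡 n) : M → Type _))
    (y : EuclideanSpace ℝ (Fin n)) : (chartMetric g φ y).transpose = chartMetric g φ y := by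
  ext a b
  exact g.symm _ _ _

lemma sum_chartMetric_mul (g : Bundle.ContMDiffRiemannianMetric (𝓡 n) ∞
      (EuclideanSpace ℝ (Fin n)) (TangentSpace (𝓡 n) : M → Type _))
    (y v w : EuclideanSpace ℝ (Fin n)) :
    ∑ a, ∑ b, v a * chartMetric g φ y a b * w b = g.inner (φ.symm y)
      (mfderiv (𝓡 n) (𝓡 n) φ.symm y v) (mfderiv (𝓡 n) (𝓡 n) φ.symm y w) := by
  have hs : ∀ v : EuclideanSpace ℝ (Fin n), v = ∑ a, v a • EuclideanSpace.single a (1 : ℝ) := by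
    intro v
    ext i
    simp [Finset.sum_apply, Pi.single_apply]
  have key : ∀ L : EuclideanSpace ℝ (Fin n) →ₗ[ℝ] EuclideanSpace ℝ (Fin n) →ₗ[ℝ] ℝ,
      L v w = ∑ a, ∑ b, v a * L (EuclideanSpace.single a 1) (EuclideanSpace.single b 1) * w b := by
    intro L
    conv_lhs => rw [hs v, hs w]
    simp only [map_sum, map_smul, LinearMap.sum_apply, LinearMap.smul_apply,
      smul_eq_mul, Finset.mul_sum]
    rw [Finset.sum_comm]
    refine Finset.sum_congr rfl fun a _ => Finset.sum_congr rfl fun b _ => by ring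
  -- The form is packaged as bilinear on the model space; tangent spaces agree with it only after
  -- unfolding.
  exact (key (LinearMap.mk₂ ℝ (fun v w => g.inner (φ.symm y)
    (mfderiv (𝓡 n) (𝓡 n) φ.symm y v) (mfderiv (𝓡 n) (𝓡 n) φ.symm y w))
    (fun _ _ _ => by erw [map_add, map_add]; rfl) (fun _ _ _ => by erw [map_smul, map_smul]; rfl)
    (fun _ _ _ => by erw [map_add, map_add]) (fun _ _ _ => by erw [map_smul, map_smul]))).symm

lemma sum_chartMetric_mul_chartFrame (g : Bundle.ContMDiffRiemannianMetric (𝓡 n) ∞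
      (EuclideanSpace ℝ (Fin n)) (TangentSpace (𝓡 n) : M → Type _))
    (hφ : φ ∈ IsManifold.maximalAtlas (𝓡 n) ∞ M) {p : M} (hp : p ∈ φ.source)
    (e : Fin n → TangentSpace (𝓡 n) p) (i j : Fin n) :
    ∑ a, ∑ b, chartFrame φ p e i a * chartMetric g φ (φ p) a b * chartFrame φ p e j b =
      g.inner p (e i) (e j) := by
  rw [sum_chartMetric_mul]
  have hcomp : ∀ v : TangentSpace (𝓡 n) p, mfderiv (𝓡 n) (𝓡 n) φ.symm (φ p)
      (mfderiv (𝓡 n) (𝓡 n) φ p v) = v := fun v =>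
    DFunLike.congr_fun ((mdifferentiable_of_mem_maximalAtlas hφ).symm_comp_deriv hp) v
  -- The base point `φ.symm (φ p)` equals `p` only propositionally; taking vectors in the model
  -- space allows substitution of the point.
  have hg : ∀ (q : M) (_ : q = p) (v w : EuclideanSpace ℝ (Fin n)),
      g.inner q (v : TangentSpace (𝓡 n) q) (w : TangentSpace (𝓡 n) q) =
        g.inner p (v : TangentSpace (𝓡 n) p) (w : TangentSpace (𝓡 n) p) := by
    rintro q rfl v w
    rfl
  refine (hg _ (φ.left_inv hp) _ _).trans ?_
  exact congrArg₂ (fun v w : TangentSpace (𝓡 n) p => g.inner p v w) (hcomp (e i)) (hcomp (e j))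

/-- A kernel vector of the matrix would push forward, injectively, to a nonzero tangent vector of
length zero, against positivity of `g`. -/
lemma isUnit_det_chartMetric (g : Bundle.ContMDiffRiemannianMetric (𝓡 n) ∞
      (EuclideanSpace ℝ (Fin n)) (TangentSpace (𝓡 n) : M → Type _))
    (hφ : φ ∈ IsManifold.maximalAtlas (𝓡 n) ∞ M) {y : EuclideanSpace ℝ (Fin n)}
    (hy : y ∈ φ.target) : IsUnit (chartMetric g φ y).det := by
  rw [isUnit_iff_ne_zero]
  intro h
  obtain ⟨v, hv, h0⟩ := Matrix.exists_mulVec_eq_zero_iff.2 h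
  apply hv
  have hsum := sum_chartMetric_mul (φ := φ) g y (WithLp.toLp 2 v) (WithLp.toLp 2 v)
  have hz : ∀ a, ∑ b, v a * chartMetric g φ y a b * v b = 0 := fun a => by
    have := congrFun h0 a
    simp only [Matrix.mulVec, dotProduct, Pi.zero_apply] at this
    simp only [mul_assoc, ← Finset.mul_sum, this, mul_zero]
  simp only [hz, Finset.sum_const_zero] at hsum
  by_contra hv0
  have hinj := ((mdifferentiable_of_mem_maximalAtlas hφ).symm.mfderiv_injective
    (x := y) (by simpa using hy))
  have hne : mfderiv (𝓡 n) (𝓡 n) φ.symm y (WithLp.toLp 2 v : EuclideanSpace ℝ (Fin n)) ≠ 0 := by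
    intro h0
    have := hinj (h0.trans (map_zero (mfderiv (𝓡 n) (𝓡 n) φ.symm y)).symm)
    exact hv0 (congrArg WithLp.ofLp this)
  exact (g.pos _ _ hne).ne hsum

end Manifold

/-! ### Contractions in an orthonormal frame and the contracted Bianchi identities. -/

section Frame

variable {n : ℕ} {G : EuclideanSpace ℝ (Fin n) → Matrix (Fin n) (Fin n) ℝ}
  {U : Set (EuclideanSpace ℝ (Fin n))} {y : EuclideanSpace ℝ (Fin n)}
  {e : Fin n → EuclideanSpace ℝ (Fin n)}

lemma sum_fin_succ_pi {k : ℕ} (f : (Fin (k + 1) → Fin n) → ℝ) :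
    ∑ β, f β = ∑ a, ∑ γ : Fin k → Fin n, f (Matrix.vecCons a γ) := by
  rw [← (Fin.consEquiv fun _ => Fin n).sum_comp, Fintype.sum_prod_type]
  rfl

lemma sum_fin_zero_pi (f : (Fin 0 → Fin n) → ℝ) : ∑ β, f β = f ![] := by
  rw [Fintype.sum_unique]
  rfl

lemma frameCovDeriv_zero (S : EuclideanSpace ℝ (Fin n) → (Fin 0 → Fin n) → ℝ) (m : Fin n) :
    frameCovDeriv G S y e ![] m = ∑ c, e m c * covDeriv G S c y ![] := by
  simp only [frameCovDeriv, sum_fin_zero_pi]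
  simp

lemma frameCovDeriv_two (S : EuclideanSpace ℝ (Fin n) → (Fin 2 → Fin n) → ℝ) (i j m : Fin n) :
    frameCovDeriv G S y e ![i, j] m =
      ∑ a, ∑ b, ∑ c, e i a * e j b * e m c * covDeriv G S c y ![a, b] := by
  simp only [frameCovDeriv, sum_fin_succ_pi, sum_fin_zero_pi]
  simp [Fin.prod_univ_two]

lemma frameCovDeriv_four (S : EuclideanSpace ℝ (Fin n) → (Fin 4 → Fin n) → ℝ)
    (i j k l m : Fin n) : frameCovDeriv G S y e ![i, j, k, l] m =
      ∑ a, ∑ b, ∑ c, ∑ d, ∑ f, e i a * e j b * e k c * e l d * e m f *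
        covDeriv G S f y ![a, b, c, d] := by
  simp only [frameCovDeriv, sum_fin_succ_pi, sum_fin_zero_pi]
  simp [Fin.prod_univ_four]

/-- `e` is an orthonormal frame for `G` at `y`. -/
def IsOrthonormalFrame (G : EuclideanSpace ℝ (Fin n) → Matrix (Fin n) (Fin n) ℝ)
    (y : EuclideanSpace ℝ (Fin n)) (e : Fin n → EuclideanSpace ℝ (Fin n)) : Prop :=
  ∀ i j, ∑ a, ∑ b, e i a * G y a b * e j b = if i = j then 1 else 0

/-- Orthonormality says $EGE^{T}=1$. A one-sided inverse of a square matrix is two-sided, so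
$GE^{T}E=1$. This turns contractions with the inverse metric into sums over the frame. -/
lemma IsOrthonormalFrame.inv_apply (he : IsOrthonormalFrame G y e) (a b : Fin n) :
    (G y)⁻¹ a b = ∑ l, e l a * e l b := by
  let E : Matrix (Fin n) (Fin n) ℝ := Matrix.of fun i a => e i a
  have h : E * (G y * E.transpose) = 1 := by
    ext i j
    rw [Matrix.one_apply, ← he i j]
    simp [E, Matrix.mul_apply, Finset.mul_sum, mul_assoc]
  have h' : G y * (E.transpose * E) = 1 := by
    rw [← mul_assoc]
    exact mul_eq_one_comm.1 h
  rw [Matrix.inv_eq_right_inv h', Matrix.mul_apply]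
  rfl

lemma sum_rotate (f : Fin n → Fin n → Fin n → ℝ) :
    ∑ a, ∑ b, ∑ c, f a b c = ∑ b, ∑ c, ∑ a, f a b c := by
  rw [Finset.sum_comm]
  exact Finset.sum_congr rfl fun b _ => Finset.sum_comm

lemma IsSmoothMetricOn.frameCovDeriv_ricci_symm (hG : IsSmoothMetricOn G U) (hy : y ∈ U)
    (i j m : Fin n) :
    frameCovDeriv G (ricci G) y e ![i, j] m = frameCovDeriv G (ricci G) y e ![j, i] m := by
  have hinv : ∀ c d, (G y)⁻¹ c d = (G y)⁻¹ d c := fun c d => by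
    conv_lhs => rw [← hG.transpose_eq, ← Matrix.transpose_nonsing_inv, Matrix.transpose_apply]
  have h : ∀ m a b, covDeriv G (ricci G) m y ![a, b] = covDeriv G (ricci G) m y ![b, a] :=
    fun m a b => by
      rw [hG.covDeriv_ricci hy, hG.covDeriv_ricci hy, Finset.sum_comm]
      refine Finset.sum_congr rfl fun c _ => Finset.sum_congr rfl fun d _ => ?_
      rw [hinv, hG.covDeriv_riemann_pair_symm hy]
  rw [frameCovDeriv_two, frameCovDeriv_two, Finset.sum_comm]
  refine Finset.sum_congr rfl fun a _ => Finset.sum_congr rfl fun b _ =>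
    Finset.sum_congr rfl fun c _ => ?_
  rw [h]
  ring

lemma IsSmoothMetricOn.frameCovDeriv_scalarCurvature (hG : IsSmoothMetricOn G U) (hy : y ∈ U)
    (he : IsOrthonormalFrame G y e) (m : Fin n) :
    frameCovDeriv G (scalarCurvature G) y e ![] m =
      ∑ l, frameCovDeriv G (ricci G) y e ![l, l] m := by
  simp only [frameCovDeriv_zero, frameCovDeriv_two, hG.covDeriv_scalarCurvature hy, he.inv_apply,
    Finset.mul_sum, Finset.sum_mul]
  -- Iterated sums are flattened to one sum over a product, so that a single equivalence permutes
  -- all summation variables.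
  calc _ = ∑ x : Fin n × Fin n × Fin n × Fin n, e m x.1 * (e x.2.2.2 x.2.1 * e x.2.2.2 x.2.2.1
        * covDeriv G (ricci G) x.1 y ![x.2.1, x.2.2.1]) := by simp only [Fintype.sum_prod_type]
    _ = ∑ x : Fin n × Fin n × Fin n × Fin n, e x.1 x.2.1 * e x.1 x.2.2.1 * e m x.2.2.2
        * covDeriv G (ricci G) x.2.2.2 y ![x.2.1, x.2.2.1] :=
      Fintype.sum_equiv ⟨fun x => (x.2.2.2, x.2.1, x.2.2.1, x.1),
        fun x => (x.2.2.2, x.2.1, x.2.2.1, x.1), fun _ => rfl, fun _ => rfl⟩ _ _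
        fun x => by simp only [Equiv.coe_fn_mk]; ring
    _ = _ := by simp only [Fintype.sum_prod_type]

lemma IsSmoothMetricOn.frameCovDeriv_ricci (hG : IsSmoothMetricOn G U) (hy : y ∈ U)
    (he : IsOrthonormalFrame G y e) (i j m : Fin n) :
    frameCovDeriv G (ricci G) y e ![i, j] m =
      ∑ l, frameCovDeriv G (riemann G) y e ![l, i, l, j] m := by
  simp only [frameCovDeriv_two, frameCovDeriv_four, hG.covDeriv_ricci hy, he.inv_apply,
    Finset.mul_sum, Finset.sum_mul]
  calc _ = ∑ x : Fin n × Fin n × Fin n × Fin n × Fin n × Fin n,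
        e i x.1 * e j x.2.1 * e m x.2.2.1 * (e x.2.2.2.2.2 x.2.2.2.1 * e x.2.2.2.2.2 x.2.2.2.2.1
        * covDeriv G (riemann G) x.2.2.1 y ![x.2.2.2.1, x.1, x.2.2.2.2.1, x.2.1]) := by
          simp only [Fintype.sum_prod_type]
    _ = ∑ x : Fin n × Fin n × Fin n × Fin n × Fin n × Fin n,
        e x.1 x.2.1 * e i x.2.2.1 * e x.1 x.2.2.2.1 * e j x.2.2.2.2.1 * e m x.2.2.2.2.2
        * covDeriv G (riemann G) x.2.2.2.2.2 y ![x.2.1, x.2.2.1, x.2.2.2.1, x.2.2.2.2.1] :=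
      Fintype.sum_equiv ⟨fun x => (x.2.2.2.2.2, x.2.2.2.1, x.1, x.2.2.2.2.1, x.2.1, x.2.2.1),
        fun x => (x.2.2.1, x.2.2.2.2.1, x.2.2.2.2.2, x.2.1, x.2.2.2.1, x.1),
        fun _ => rfl, fun _ => rfl⟩ _ _ fun x => by simp only [Equiv.coe_fn_mk]; ring
    _ = _ := by simp only [Fintype.sum_prod_type]

lemma IsSmoothMetricOn.frameCovDeriv_riemann_bianchi (hG : IsSmoothMetricOn G U) (hy : y ∈ U)
    (i j k l m : Fin n) :
    frameCovDeriv G (riemann G) y e ![i, j, k, l] m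
      + frameCovDeriv G (riemann G) y e ![i, j, l, m] k
      + frameCovDeriv G (riemann G) y e ![i, j, m, k] l = 0 := by
  simp only [frameCovDeriv_four, ← Finset.sum_add_distrib]
  refine Finset.sum_eq_zero fun a _ => Finset.sum_eq_zero fun b _ => ?_
  simp only [Finset.sum_add_distrib]
  -- Cyclic renaming gives all three sums the same frame factors, leaving the coordinate Bianchi
  -- identity as common bracket.
  rw [sum_rotate fun c d f => e i a * e j b * e m c * e k d * e l f *
      covDeriv G (riemann G) f y ![a, b, c, d],
    ← sum_rotate fun f c d => e i a * e j b * e l c * e m d * e k f *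
      covDeriv G (riemann G) f y ![a, b, c, d]]
  simp only [← Finset.sum_add_distrib]
  refine Finset.sum_eq_zero fun c _ => Finset.sum_eq_zero fun d _ => Finset.sum_eq_zero fun f _ => ?_
  linear_combination e i a * e j b * e k c * e l d * e m f *
    hG.covDeriv_riemann_bianchi hy f a b c d

lemma frameCovDeriv_riemann_antisymm_right (i j k l m : Fin n) :
    frameCovDeriv G (riemann G) y e ![i, j, l, k] m =
      - frameCovDeriv G (riemann G) y e ![i, j, k, l] m := by
  simp only [frameCovDeriv_four, ← Finset.sum_neg_distrib]
  refine Finset.sum_congr rfl fun a _ => Finset.sum_congr rfl fun b _ => ?_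
  rw [Finset.sum_comm]
  refine Finset.sum_congr rfl fun c _ => Finset.sum_congr rfl fun d _ =>
    Finset.sum_congr rfl fun f _ => ?_
  rw [covDeriv_riemann_antisymm_right]
  ring

lemma IsSmoothMetricOn.frameCovDeriv_riemann_antisymm_both (hG : IsSmoothMetricOn G U)
    (hy : y ∈ U) (i j k l m : Fin n) :
    frameCovDeriv G (riemann G) y e ![j, i, l, k] m =
      frameCovDeriv G (riemann G) y e ![i, j, k, l] m := by
  simp only [frameCovDeriv_four]
  rw [Finset.sum_comm]
  refine Finset.sum_congr rfl fun a _ => Finset.sum_congr rfl fun b _ => ?_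
  rw [Finset.sum_comm]
  refine Finset.sum_congr rfl fun c _ => Finset.sum_congr rfl fun d _ =>
    Finset.sum_congr rfl fun f _ => ?_
  rw [hG.covDeriv_riemann_antisymm_both hy]
  ring

/-- The divergence of the Riemann tensor is the exterior covariant derivative of the Ricci
tensor. -/
theorem IsSmoothMetricOn.divRiemann_eq (hG : IsSmoothMetricOn G U) (hy : y ∈ U)
    (he : IsOrthonormalFrame G y e) (i j k : Fin n) :
    divRiemann G y e i j k =
      frameCovDeriv G (ricci G) y e ![i, k] j - frameCovDeriv G (ricci G) y e ![i, j] k := by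
  rw [divRiemann, hG.frameCovDeriv_ricci hy he, hG.frameCovDeriv_ricci hy he,
    ← Finset.sum_sub_distrib]
  refine Finset.sum_congr rfl fun l _ => ?_
  -- For fixed `l`: $R_{lijk,l}+R_{likl,j}+R_{lilj,k}=0$ and $R_{likl,j}=-R_{lilk,j}$; the remaining
  -- terms are the Ricci summands.
  linarith [hG.frameCovDeriv_riemann_bianchi hy (e := e) l i j k l,
    frameCovDeriv_riemann_antisymm_right (G := G) (y := y) (e := e) l i l k j]

/-- The contracted Bianchi identity `2 ∑ l, R_{il,l} = R_{,i}`. -/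
theorem IsSmoothMetricOn.contracted_bianchi (hG : IsSmoothMetricOn G U) (hy : y ∈ U)
    (he : IsOrthonormalFrame G y e) (i : Fin n) :
    2 * ∑ l, frameCovDeriv G (ricci G) y e ![i, l] l =
      frameCovDeriv G (scalarCurvature G) y e ![] i := by
  -- The trace $\sum_l T_{lil}$ is computed twice: by contracting the curvature directly, giving
  -- $\sum_l R_{il,l}$, and through `divRiemann_eq`, giving $R_{,i}-\sum_l R_{il,l}$.
  have h1 : ∑ l, divRiemann G y e l i l = ∑ l, frameCovDeriv G (ricci G) y e ![i, l] l := by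
    simp only [divRiemann]
    rw [Finset.sum_comm]
    refine Finset.sum_congr rfl fun m _ => ?_
    rw [hG.frameCovDeriv_ricci_symm hy, hG.frameCovDeriv_ricci hy he]
    exact Finset.sum_congr rfl fun l _ => hG.frameCovDeriv_riemann_antisymm_both hy l m l i m
  simp only [hG.divRiemann_eq hy he, Finset.sum_sub_distrib,
    ← hG.frameCovDeriv_scalarCurvature hy he] at h1
  simp only [fun l => hG.frameCovDeriv_ricci_symm hy (e := e) l i l] at h1
  linarith

theorem IsSmoothMetricOn.isMinimalNormTensor_divRiemann_iff (hn : 2 ≤ n)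
    (hG : IsSmoothMetricOn G U) (hy : y ∈ U) (he : IsOrthonormalFrame G y e)
    (F : Fin n → Fin n → Fin n → ℝ) :
    IsMinimalNormTensor (divRiemann G y e) F ↔ F = cotton G y e :=
  isMinimalNormTensor_iff_of_contracted_bianchi hn
    (P := fun i j k => frameCovDeriv G (ricci G) y e ![i, j] k)
    (s := frameCovDeriv G (scalarCurvature G) y e ![]) (hG.divRiemann_eq hy he)
    (hG.frameCovDeriv_ricci_symm hy) (hG.frameCovDeriv_scalarCurvature hy he)
    (hG.contracted_bianchi hy he)

end Frame

end CottonMinimal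

end

theorem corollary1p2 {n : ℕ} (hn : 2 ≤ n)
    {M : Type*} [TopologicalSpace M] [ChartedSpace (EuclideanSpace ℝ (Fin n)) M]
    [IsManifold (𝓡 n) ∞ M]
    (g : Bundle.ContMDiffRiemannianMetric (𝓡 n) ∞ (EuclideanSpace ℝ (Fin n))
      (TangentSpace (𝓡 n) : M → Type _))
    (p : M) (φ : OpenPartialHomeomorph M (EuclideanSpace ℝ (Fin n)))
    (hφ : φ ∈ IsManifold.maximalAtlas (𝓡 n) ∞ M) (hp : p ∈ φ.source)
    (e : Fin n → TangentSpace (𝓡 n) p)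
    (he : ∀ i j, g.inner p (e i) (e j) = if i = j then 1 else 0)
    (F : Fin n → Fin n → Fin n → ℝ) :
    CottonMinimal.IsMinimalNormTensor
        (CottonMinimal.divRiemann (CottonMinimal.chartMetric g φ) (φ p)
          (CottonMinimal.chartFrame φ p e)) F ↔
      F = CottonMinimal.cotton (CottonMinimal.chartMetric g φ) (φ p)
          (CottonMinimal.chartFrame φ p e) := by
  have hG : CottonMinimal.IsSmoothMetricOn (CottonMinimal.chartMetric g φ) φ.target :=
    ⟨φ.open_target, CottonMinimal.contDiffOn_chartMetric g hφ, CottonMinimal.chartMetric_symm g,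
      fun _ => CottonMinimal.isUnit_det_chartMetric g hφ⟩
  refine hG.isMinimalNormTensor_divRiemann_iff hn (φ.map_source hp) (fun i j => ?_) F
  rw [CottonMinimal.sum_chartMetric_mul_chartFrame g hφ hp, he]
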